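/- Let $[z]$ be a nonzero entire function of $z\in\mathbb{C}$ satisfying, for all $z,\alpha,\beta,\gamma\in\mathbb{C}$, $$[z\pm\alpha][\beta\pm\gamma]+[z\pm\beta][\gamma\pm\alpha]+[z\pm\gamma][\alpha\pm\beta]=0,\qquad [a\pm b]:=[a+b][a-b].$$ Let $n\ge 0$ be an integer and $\delta,\kappa\in\mathbb{C}$. On meromorphic functions of $x=(x_1,\dots,x_n)\in\mathbb{C}^n$ let $T_{x_i}^{a}$ be the shift $x_i\mapsto x_i+a$, and for $r,l=0,1,2,\dots$ define the difference operators $$D_r=\sum_{I\subseteq\{1,\dots,n\},\ |I|=r}\ \prod_{i\in I,\ j\notin I}\frac{[x_i-x_j+\kappa]}{[x_i-x_j]}\ \prod_{i\in I}T_{x_i}^{\delta},$$ $$H_l=\sum_{\substack{\mu\in\mathbb{Z}_{\ge0}^n\\ \mu_1+\cdots+\mu_n=l}}\ \prod_{1\le i<j\le n}\frac{[x_i-x_j+(\mu_i-\mu_j)\delta]}{[x_i-x_j]}\ \prod_{i,j=1}^{n}\ \prod_{k=0}^{\mu_i-1}\frac{[x_i-x_j+\kappa+k\delta]}{[x_i-x_j+\delta+k\delta]}\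 \prod_{i=1}^{n}T_{x_i}^{\mu_i\delta}$$ (so $D_0=H_0=1$, and $D_r=0$ for $r>n$). Let $l\ge 1$ be an integer such that $[m\delta]\neq0$ for all integers $1\le m\le l$, so that the denominators in $H_0,\dots,H_l$ do not vanish identically. Then $$\sum_{\substack{r+s=l\\ r,s\ge 0}}(-1)^r\,[r\kappa+s\delta]\,D_r\,H_s=0 .$$ -/

import Mathlib

namespace RuijsenaarsWronski

/-- The three-term relation of Hirota type
`[z ± α][β ± γ] + [z ± β][γ ± α] + [z ± γ][α ± β] = 0`, where `[a ± b] = [a + b][a - b]`. -/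
def HirotaRelation (φ : ℂ → ℂ) : Prop :=
  ∀ z α β γ : ℂ,
    (φ (z + α) * φ (z - α)) * (φ (β + γ) * φ (β - γ)) +
      (φ (z + β) * φ (z - β)) * (φ (γ + α) * φ (γ - α)) +
      (φ (z + γ) * φ (z - γ)) * (φ (α + β) * φ (α - β)) = 0

/-- The `ℂ`-algebra of entire functions on `ℂⁿ`, with pointwise operations. -/
def Entire (n : ℕ) : Subalgebra ℂ ((Fin n → ℂ) → ℂ) where
  carrier := {f | AnalyticOnNhd ℂ f Set.univ}
  mul_mem' := fun hf hg => AnalyticOnNhd.mul hf hg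
  add_mem' := fun hf hg => AnalyticOnNhd.add hf hg
  algebraMap_mem' := fun c => (analyticOnNhd_const : AnalyticOnNhd ℂ (fun _ => c) Set.univ)

instance (n : ℕ) : NoZeroDivisors (Entire n) where
  eq_zero_or_eq_zero_of_mul_eq_zero := by
    rintro ⟨f, hf⟩ ⟨g, hg⟩ h
    have hfg : ∀ x, f x * g x = 0 := fun x => congrFun (congrArg Subtype.val h) x
    by_cases hf0 : f = 0
    · exact Or.inl (Subtype.ext hf0)
    · right
      obtain ⟨x, hx⟩ := Function.ne_iff.mp hf0
      have hf' : AnalyticOnNhd ℂ f Set.univ := hf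
      have hg' : AnalyticOnNhd ℂ g Set.univ := hg
      have hev : ∀ᶠ y in nhds x, f y ≠ 0 :=
        (hf' x (Set.mem_univ x)).continuousAt.eventually_ne hx
      have hg0 : g =ᶠ[nhds x] 0 := by
        filter_upwards [hev] with y hy
        exact (mul_eq_zero.mp (hfg y)).resolve_left hy
      exact Subtype.ext
        (hg'.eq_of_eventuallyEq (fun _ _ => analyticAt_const) hg0)

instance (n : ℕ) : IsDomain (Entire n) :=
  NoZeroDivisors.to_isDomain _

/-- The field of meromorphic functions on `ℂⁿ`, as the field of quotients of entire functions. -/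
abbrev Mero (n : ℕ) : Type := FractionRing (Entire n)

/-- Translation `f(x) ↦ f(x + a)` of entire functions. -/
def shiftEntireHom {n : ℕ} (a : Fin n → ℂ) : Entire n →ₐ[ℂ] Entire n where
  toFun f := ⟨fun x => f.1 (x + a), fun x _ =>
    (f.2 (x + a) (Set.mem_univ _)).comp_of_eq (analyticAt_id.add analyticAt_const) rfl⟩
  map_one' := rfl
  map_mul' _ _ := rfl
  map_zero' := rfl
  map_add' _ _ := rfl
  commutes' _ := rfl

/-- Translation by `a` as an automorphism; its inverse is the translation by `-a`. -/
def shiftEntire {n : ℕ} (a : Fin n → ℂ) : Entire n ≃ₐ[ℂ] Entire n :=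
  AlgEquiv.ofAlgHom (shiftEntireHom a) (shiftEntireHom (-a))
    (by
      ext f x
      exact congrArg f.1 (add_neg_cancel_right x a))
    (by
      ext f x
      exact congrArg f.1 (neg_add_cancel_right x a))

/-- The shift operator `T_x^a : f(x) ↦ f(x + a)` on meromorphic functions on `ℂⁿ`. -/
noncomputable def shift {n : ℕ} (a : Fin n → ℂ) : Module.End ℂ (Mero n) :=
  (IsFractionRing.algEquivOfAlgEquiv (shiftEntire a) : Mero n ≃ₐ[ℂ] Mero n).toLinearMap

/-- The function `[x_i - x_j + c]` of `x ∈ ℂⁿ`, as a meromorphic function. -/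
noncomputable def bracket {n : ℕ} (φ : ℂ → ℂ) (hφ : Differentiable ℂ φ) (i j : Fin n) (c : ℂ) :
    Mero n :=
  algebraMap (Entire n) (Mero n) ⟨fun x => φ (x i - x j + c), fun x _ =>
    (hφ.analyticAt (x i - x j + c)).comp_of_eq
      ((((ContinuousLinearMap.proj i : (Fin n → ℂ) →L[ℂ] ℂ).analyticAt x).sub
        ((ContinuousLinearMap.proj j : (Fin n → ℂ) →L[ℂ] ℂ).analyticAt x)).add
        analyticAt_const) rfl⟩

/-- The Ruijsenaars operator
`D_r = ∑_{|I| = r} ∏_{i ∈ I, j ∉ I} [x_i - x_j + κ] / [x_i - x_j] · ∏_{i ∈ I} T_{x_i}^δ`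
(multiplication by a meromorphic function after a shift). -/
noncomputable def opD (φ : ℂ → ℂ) (hφ : Differentiable ℂ φ) (n : ℕ) (δ κ : ℂ) (r : ℕ) :
    Module.End ℂ (Mero n) :=
  ∑ I ∈ (Finset.univ : Finset (Fin n)).powersetCard r,
    LinearMap.mulLeft ℂ (∏ i ∈ I, ∏ j ∈ Iᶜ, bracket φ hφ i j κ / bracket φ hφ i j 0) *
      shift (fun i => if i ∈ I then δ else 0)

/-- The operator `H_l`, the sum over `μ ∈ ℕⁿ` with `μ_1 + ⋯ + μ_n = l` of
`∏_{i < j} [x_i - x_j + (μ_i - μ_j)δ] / [x_i - x_j] ·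
  ∏_{i, j} ∏_{0 ≤ k < μ_i} [x_i - x_j + κ + kδ] / [x_i - x_j + δ + kδ] · ∏_i T_{x_i}^{μ_i δ}`. -/
noncomputable def opH (φ : ℂ → ℂ) (hφ : Differentiable ℂ φ) (n : ℕ) (δ κ : ℂ) (l : ℕ) :
    Module.End ℂ (Mero n) :=
  ∑ μ ∈ Finset.piAntidiag (Finset.univ : Finset (Fin n)) l,
    LinearMap.mulLeft ℂ
      ((∏ i : Fin n, ∏ j ∈ Finset.Ioi i,
          bracket φ hφ i j (((μ i : ℂ) - (μ j : ℂ)) * δ) / bracket φ hφ i j 0) *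
        ∏ i : Fin n, ∏ j : Fin n, ∏ k ∈ Finset.range (μ i),
          bracket φ hφ i j (κ + (k : ℂ) * δ) / bracket φ hφ i j (δ + (k : ℂ) * δ)) *
      shift (fun i => (μ i : ℂ) * δ)

end RuijsenaarsWronski

/-!
Collecting the terms with the same shift `∏ T_{x_i}^{λ_i δ}`, one has to show for each `λ` with
`|λ| = l` that an alternating sum over the subsets `I` of the support `S` of `λ` vanishes, the term
of `I` being the coefficient of `I` in `D_{|I|}` times the translate along `I` of the coefficient of
`λ - 1_I` in `H_{l - |I|}`. Almost everything in this product is independent of `I`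
(`rising_product_shift`, `vandermonde_shift`). With `z_i = x_i + λ_i δ` and `c = κ - δ`, what
remains is, after changing the signs of `x` and `z`, the identity `source_identity`
`∑_{I ⊆ S} (-1)^{|I|} [∑ (x_i - z_i) + |I| c] ∏_{i ∈ I, j ∈ S \ I} [x_i - x_j + c] / [x_i - x_j]
  ∏_{i ∈ I, j ∈ S} [x_i - z_j] ∏_{i ∈ S \ I, j ∈ S} [x_i - z_j + c] = 0`.

This identity holds for arbitrary points `x`, `z`. By Frobenius' formula (`frobenius_det`), the
elliptic Cauchy determinant with entries `f_j(x_i)`, `f_j(u) = [u - z_j + t] / [u - z_j]`, is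
`[t]^{n - 1} [t + ∑ (x_i - z_i)]` times a Vandermonde-type product over `∏ [x_i - z_j]`. Expanding
the determinant with entries `f_j(x_i) - ρ f_j(x_i + c)` in its rows gives the sum over `I`, with
`(-ρ)^{|I|}` and `t` inserted. There is a weight `ρ = ρ(t)`, independent of `x` and `z` and
with `ρ(0) = 1`, for which the three-term relation makes every entry divisible by `[t]`
(`HirotaRelation.two_point`), so that this determinant is divisible by `[t]^n`. Dividing by
`[t]^{n - 1}` and letting `t → 0` gives the identity. Frobenius' formula follows from the three-term
relation by induction, as the Schur complement of one entry is a matrix of the same kind. No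
classification of the solutions `[z]` is needed: they enter through oddness, the three-term
relation, and the fact that the zeros of an entire function are isolated.

Identities between meromorphic functions are checked at the points of `ℂⁿ` off the zero set of a
nonzero entire function; `Represents` records that a meromorphic function takes given values there.
-/

namespace RuijsenaarsWronski

open Filter Topology

/-! ### Consequences of the three-term relation -/

lemma eventually_ne_zero {φ : ℂ → ℂ} (hφ : Differentiable ℂ φ) (hφ0 : φ ≠ 0) (t₀ : ℂ) :
    ∀ᶠ t in 𝓝[≠] t₀, φ t ≠ 0 := by
  have hA : AnalyticOnNhd ℂ φ Set.univ := fun x _ => hφ.analyticAt x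
  rcases hA.eqOn_zero_or_eventually_ne_zero_of_preconnected isPreconnected_univ with h | h
  · exact absurd (funext fun x => h (Set.mem_univ x)) hφ0
  · have h' : ∀ᶠ t in codiscrete ℂ, φ t ≠ 0 := h
    rw [Filter.Eventually, mem_codiscrete] at h'
    have h2 := h' t₀
    rw [Filter.disjoint_principal_right, compl_compl] at h2
    exact h2

lemma tendsto_add_const_punctured (a t₀ : ℂ) :
    Tendsto (fun t => t + a) (𝓝[≠] t₀) (𝓝[≠] (t₀ + a)) := by
  refine tendsto_nhdsWithin_iff.mpr ⟨?_, ?_⟩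
  · exact ((continuous_id.add continuous_const).tendsto t₀).mono_left nhdsWithin_le_nhds
  · filter_upwards [self_mem_nhdsWithin] with t ht h
    exact ht (add_right_cancel h)

lemma eventually_add_ne_zero {φ : ℂ → ℂ} (hφ : Differentiable ℂ φ) (hφ0 : φ ≠ 0) (a t₀ : ℂ) :
    ∀ᶠ t in 𝓝[≠] t₀, φ (t + a) ≠ 0 :=
  (tendsto_add_const_punctured a t₀).eventually (eventually_ne_zero hφ hφ0 _)

lemma eq_of_eventually_eq_punctured {f g : ℂ → ℂ} {t₀ : ℂ} (hf : ContinuousAt f t₀)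
    (hg : ContinuousAt g t₀) (h : ∀ᶠ t in 𝓝[≠] t₀, f t = g t) : f t₀ = g t₀ :=
  tendsto_nhds_unique_of_eventuallyEq (hf.tendsto.mono_left nhdsWithin_le_nhds)
    (hg.tendsto.mono_left nhdsWithin_le_nhds) h

namespace HirotaRelation
variable {φ : ℂ → ℂ}

lemma map_zero (hH : HirotaRelation φ) : φ 0 = 0 := by
  have h := hH 0 0 0 0
  simp only [add_zero, sub_zero] at h
  have : φ 0 ^ 4 = 0 := by linear_combination h / 3
  exact pow_eq_zero_iff (by norm_num) |>.mp this

lemma map_neg (hH : HirotaRelation φ) (hφ : Differentiable ℂ φ) (hφ0 : φ ≠ 0) (w : ℂ) :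
    φ (-w) = -φ w := by
  obtain ⟨q, hq⟩ := (eventually_ne_zero hφ hφ0 0).exists
  obtain ⟨p, hp, hpq⟩ :=
    ((eventually_ne_zero hφ hφ0 0).and (eventually_add_ne_zero hφ hφ0 (-q - w) 0)).exists
  -- `z = (p + q) / 2`, `β = γ = (p - q) / 2` and `α = β - w`
  have h := hH ((p + q) / 2) ((p - q) / 2 - w) ((p - q) / 2) ((p - q) / 2)
  rw [sub_self, hH.map_zero, show (p + q) / 2 + (p - q) / 2 = p by ring,
    show (p + q) / 2 - (p - q) / 2 = q by ring,
    show (p - q) / 2 + ((p - q) / 2 - w) = p + (-q - w) by ring,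
    show (p - q) / 2 - w + (p - q) / 2 = p + (-q - w) by ring,
    show (p - q) / 2 - ((p - q) / 2 - w) = w by ring,
    show (p - q) / 2 - w - (p - q) / 2 = -w by ring] at h
  have h' : (φ p * φ q * φ (p + (-q - w))) * (φ (-w) + φ w) = 0 := by linear_combination h
  have := (mul_eq_zero.mp h').resolve_left (mul_ne_zero (mul_ne_zero hp hq) hpq)
  linear_combination this

/-- The three-term relation in the form of an addition formula with free parameters
`a, b, p, q, t`. -/
lemma three_term (hH : HirotaRelation φ) (a b p q t : ℂ) :
    φ (a - b + t) * φ (p - q + t) * (φ (a - q) * φ (p - b)) +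
      φ (a - b + (t + (p - q))) * φ t * (φ (a - p) * φ (b - q)) +
      φ (a - q + t) * φ (p - b + t) * (φ (a - b) * φ (q - p)) = 0 := by
  have h := hH ((a - b + p - q + 2 * t) / 2) ((a - b - p + q) / 2) ((a + p - q - b) / 2)
    ((a - p + b - q) / 2)
  ring_nf at h ⊢
  exact h

end HirotaRelation

/-! ### The elliptic Cauchy determinant -/

/-- Frobenius' evaluation of the elliptic Cauchy determinant, with denominators cleared. -/
theorem frobenius_det {φ : ℂ → ℂ} (hφ : Differentiable ℂ φ) (hφ0 : φ ≠ 0)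
    (hH : HirotaRelation φ) (n : ℕ) :
    ∀ (x z : Fin n → ℂ) (_ : ∀ i j, φ (x i - z j) ≠ 0) (t : ℂ),
      φ t * (Matrix.of fun i j => φ (x i - z j + t) / φ (x i - z j)).det *
          ∏ i, ∏ j, φ (x i - z j) =
        φ t ^ n * φ (t + ∑ i, (x i - z i)) *
          ∏ i, ∏ j ∈ Finset.Ioi i, φ (x i - x j) * φ (z j - z i) := by
  induction n with
  | zero => intro x z _ t; simp
  | succ n ih =>
    intro x z hxz t₀
    have hc := hφ.continuous
    have hodd := hH.map_neg hφ hφ0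
    refine eq_of_eventually_eq_punctured (t₀ := t₀)
      (f := fun t => φ t * (Matrix.of fun i j => φ (x i - z j + t) / φ (x i - z j)).det *
          ∏ i, ∏ j, φ (x i - z j))
      (g := fun t => φ t ^ (n + 1) * φ (t + ∑ i, (x i - z i)) *
          ∏ i, ∏ j ∈ Finset.Ioi i, φ (x i - x j) * φ (z j - z i)) ?_ ?_ ?_
    · refine Continuous.continuousAt ?_
      refine (hc.mul (Continuous.matrix_det ?_)).mul continuous_const
      refine continuous_matrix fun i j => ?_
      exact (hc.comp (by fun_prop)).div_const _
    · exact Continuous.continuousAt (by fun_prop)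
    filter_upwards [eventually_ne_zero hφ hφ0 t₀,
      eventually_add_ne_zero hφ hφ0 (x 0 - z 0) t₀] with t ht ht'
    have hih := ih (fun i => x i.succ) (fun i => z i.succ) (fun i j => hxz _ _) (t + (x 0 - z 0))
    set t' := t + (x 0 - z 0) with ht'def
    set M' : Matrix (Fin n) (Fin n) ℂ :=
      Matrix.of fun i j => φ (x i.succ - z j.succ + t') / φ (x i.succ - z j.succ) with hM'
    set M : Matrix (Fin (n + 1)) (Fin (n + 1)) ℂ :=
      Matrix.of fun i j => φ (x i - z j + t) / φ (x i - z j) with hM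
    have hM00 : M 0 0 = φ t' / φ (x 0 - z 0) := by
      simp only [hM, Matrix.of_apply, ht'def]; rw [add_comm]
    have hM00' : M 0 0 ≠ 0 := by rw [hM00]; exact div_ne_zero ht' (hxz 0 0)
    -- the pivot `M 0 0` clears the first column
    have hdet : M.det = (Matrix.of fun i j => if i = 0 then M 0 j else
        M i j - M i 0 / M 0 0 * M 0 j).det := by
      refine Matrix.det_eq_of_forall_row_eq_smul_add_const
        (fun i => if i = 0 then 0 else M i 0 / M 0 0) 0 (by simp) fun i j => ?_
      by_cases hi : i = 0
      · simp [hi]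
      · simp [hi]
    -- the Schur complement is again a matrix of the same kind, up to row and column factors
    have hdet' : M.det = M 0 0 * ((φ t / φ t') ^ n *
        ((∏ i : Fin n, φ (x 0 - x i.succ) / φ (x i.succ - z 0)) *
        ((∏ j : Fin n, φ (z j.succ - z 0) / φ (x 0 - z j.succ)) * M'.det))) := by
      rw [hdet, Matrix.det_succ_column_zero, Fin.sum_univ_succ]
      have hz : ∀ i : Fin n, (Matrix.of fun i j => if i = 0 then M 0 j else
        M i j - M i 0 / M 0 0 * M 0 j) i.succ 0 = 0 := by
        intro i
        simp only [Matrix.of_apply, Fin.succ_ne_zero, if_false]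
        field_simp
        simp
      simp only [hz, mul_zero, zero_mul, Finset.sum_const_zero, add_zero]
      simp only [Fin.val_zero, pow_zero, one_mul, Matrix.of_apply, if_true]
      congr 1
      rw [← Matrix.det_mul_row, ← Matrix.det_mul_column]
      have hsmul := fun A : Matrix (Fin n) (Fin n) ℂ => Matrix.det_smul A (φ t / φ t')
      simp only [Fintype.card_fin] at hsmul
      rw [← hsmul]
      congr 1
      ext i j
      simp only [Matrix.submatrix_apply, Matrix.of_apply, Fin.succ_ne_zero, Fin.succAbove_zero,
        if_false, Matrix.smul_apply, smul_eq_mul, hM00]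
      simp only [hM, hM', Matrix.of_apply]
      have h3 := hH.three_term (x i.succ) (z j.succ) (x 0) (z 0) t
      rw [← ht'def, ← neg_sub (x 0) (z 0), ← neg_sub (x 0) (x i.succ), hodd, hodd,
        add_comm (x 0 - z 0) t, ← ht'def] at h3
      have h1 := hxz i.succ j.succ
      have h2 := hxz i.succ 0
      have h4 := hxz 0 j.succ
      have h5 := hxz 0 0
      field_simp
      linear_combination h3
    rw [hdet', hM00]
    have hpr : ∏ i, ∏ j, φ (x i - z j) = (φ (x 0 - z 0) * ∏ j : Fin n, φ (x 0 - z j.succ)) *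
        ((∏ i : Fin n, φ (x i.succ - z 0)) * ∏ i : Fin n, ∏ j : Fin n,
          φ (x i.succ - z j.succ)) := by
      rw [Fin.prod_univ_succ, Fin.prod_univ_succ, ← Finset.prod_mul_distrib]
      congr 1
      exact Finset.prod_congr rfl fun i _ => Fin.prod_univ_succ _
    have hvd : ∏ i : Fin (n + 1), ∏ j ∈ Finset.Ioi i, φ (x i - x j) * φ (z j - z i) =
        ((∏ j : Fin n, φ (x 0 - x j.succ)) * ∏ j : Fin n, φ (z j.succ - z 0)) *
        ∏ i : Fin n, ∏ j ∈ Finset.Ioi i, φ (x i.succ - x j.succ) * φ (z j.succ - z i.succ) := by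
      rw [Fin.prod_univ_succ, Fin.prod_Ioi_zero, Finset.prod_mul_distrib]
      congr 1
      exact Finset.prod_congr rfl fun i _ => Fin.prod_Ioi_succ _ _
    rw [hpr, hvd, Fin.sum_univ_succ, ← add_assoc, ← ht'def]
    have hP1 : ∏ i : Fin n, φ (x i.succ - z 0) ≠ 0 := Finset.prod_ne_zero_iff.mpr fun i _ => hxz _ _
    have hP2 : ∏ i : Fin n, φ (x 0 - z i.succ) ≠ 0 := Finset.prod_ne_zero_iff.mpr fun i _ => hxz _ _
    simp only [Finset.prod_div_distrib, div_pow]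
    have h5 := hxz 0 0
    have hpow : φ t' ^ n ≠ 0 := pow_ne_zero _ ht'
    field_simp
    rw [pow_succ]
    linear_combination (φ t * φ t ^ n * (∏ i : Fin n, φ (x 0 - x i.succ)) *
      (∏ i : Fin n, φ (z i.succ - z 0))) * hih

/-! ### The identity over subsets obtained from the determinant -/

lemma prod_prod_compl_eq_prod_Ioi {ι R : Type*} [Fintype ι] [LinearOrder ι]
    [LocallyFiniteOrderTop ι] [LocallyFiniteOrderBot ι] [CommMonoid R] (I : Finset ι)
    (f : ι → ι → R) :
    ∏ i ∈ I, ∏ j ∈ Iᶜ, f i j = ∏ i, ∏ j ∈ Finset.Ioi i,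
      (if j ∈ I ∧ i ∉ I then f j i else 1) * (if i ∈ I ∧ j ∉ I then f i j else 1) := by
  rw [Finset.prod_prod_Ioi_mul_eq_prod_prod_off_diag
    (fun i j => if i ∈ I ∧ j ∉ I then f i j else 1)]
  have h1 : ∀ i, ∏ j ∈ ({i}ᶜ : Finset ι), (if j ∈ I ∧ i ∉ I then f j i else 1) =
      ∏ j, (if j ∈ I ∧ i ∉ I then f j i else 1) := by
    intro i
    refine Finset.prod_subset (Finset.subset_univ _) fun j _ hj => ?_
    have : j = i := by simpa using hj
    subst this
    simp
  simp_rw [h1]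
  conv_rhs => rw [Finset.prod_comm]
  have h2 : ∀ i, ∏ j, (if i ∈ I ∧ j ∉ I then f i j else 1) =
      if i ∈ I then ∏ j ∈ Iᶜ, f i j else 1 := by
    intro i
    by_cases hi : i ∈ I
    · simp only [hi, true_and, if_true, ← Finset.mem_compl]
      rw [Finset.prod_ite_mem, Finset.univ_inter]
    · simp [hi]
  simp_rw [h2]
  rw [Finset.prod_ite_mem, Finset.univ_inter]

/-- The effect on the Vandermonde-type product `∏ [x_i - x_j]` of translating the variables
in `I` by `a`. -/
lemma vandermonde_shift {φ : ℂ → ℂ} (hodd : ∀ w, φ (-w) = -φ w) {ι : Type*} [Fintype ι]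
    [LinearOrder ι] [LocallyFiniteOrderTop ι] [LocallyFiniteOrderBot ι] (x : ι → ℂ) (a : ℂ)
    (I : Finset ι) :
    (∏ i, ∏ j ∈ Finset.Ioi i,
        φ ((x i + if i ∈ I then a else 0) - (x j + if j ∈ I then a else 0))) *
        ∏ i ∈ I, ∏ j ∈ Iᶜ, φ (x i - x j) =
      (∏ i, ∏ j ∈ Finset.Ioi i, φ (x i - x j)) * ∏ i ∈ I, ∏ j ∈ Iᶜ, φ (x i - x j + a) := by
  rw [prod_prod_compl_eq_prod_Ioi, prod_prod_compl_eq_prod_Ioi, ← Finset.prod_mul_distrib,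
    ← Finset.prod_mul_distrib]
  refine Finset.prod_congr rfl fun i _ => ?_
  rw [← Finset.prod_mul_distrib, ← Finset.prod_mul_distrib]
  refine Finset.prod_congr rfl fun j _ => ?_
  by_cases hi : i ∈ I <;> by_cases hj : j ∈ I <;> simp only [hi, hj, not_true, not_false_iff,
    and_true, and_false, if_true, if_false, mul_one, one_mul, add_zero,
    add_sub_add_right_eq_sub]
  · rw [show x i + a - x j = x i - x j + a by ring]; ring
  · rw [show x i - (x j + a) = -(x j - x i + a) by ring, ← neg_sub (x j) (x i), hodd, hodd]
    ring

/-- The values of `[u + t] / [u]` at `u` and `u + c`, combined with a weight that does not depend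
on `u` and tends to `-1` as `t → 0`, give a function of `u` divisible by `[t]`. -/
lemma HirotaRelation.two_point {φ : ℂ → ℂ} (hH : HirotaRelation φ) (hφ : Differentiable ℂ φ)
    (hφ0 : φ ≠ 0) {p c t u : ℂ} (hp : φ p ≠ 0) (hpct : φ (p - c - t) ≠ 0) (hu : φ u ≠ 0)
    (huc : φ (u + c) ≠ 0) :
    -(φ (p - c) * φ (p - t) / (φ p * φ (p - c - t))) * (φ (u + c + t) / φ (u + c)) +
        φ (u + t) / φ u =
      φ t * (-(φ c * φ (u + p) * φ (u - p + c + t)) /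
        (φ p * φ (p - c - t) * (φ u * φ (u + c)))) := by
  have h := hH.three_term u 0 (p - c - t) (-c) t
  rw [show u - 0 + t = u + t by ring, show p - c - t - -c + t = p by ring,
    show u - -c = u + c by ring, show p - c - t - 0 = p - c - t by ring,
    show u - 0 + (t + (p - c - t - -c)) = u + p by ring,
    show u - (p - c - t) = u - p + c + t by ring, show 0 - -c = c by ring,
    show p - c - t + t = p - c by ring, sub_zero,
    show -c - (p - c - t) = -(p - t) by ring, hH.map_neg hφ hφ0] at h
  field_simp
  linear_combination h

/-- Expansion of a determinant whose rows are sums, by multilinearity. -/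
lemma sum_weighted_det {n : ℕ} (A B : Matrix (Fin n) (Fin n) ℂ) (ρ : ℂ) :
    ∑ I : Finset (Fin n), ρ ^ I.card * (Matrix.of fun i j => if i ∈ I then A i j else B i j).det =
      (Matrix.of fun i j => ρ * A i j + B i j).det := by
  have h := (Matrix.detRowAlternating (n := Fin n) (R := ℂ)).map_add_univ
    (fun i j => ρ * A i j) (fun i j => B i j)
  have h2 : (Matrix.of fun i j => ρ * A i j + B i j).det = _ := h
  rw [h2]
  refine Finset.sum_congr rfl fun I _ => ?_
  have h3 := Matrix.det_mul_column (fun i : Fin n => if i ∈ I then ρ else 1)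
    (Matrix.of fun i j => if i ∈ I then A i j else B i j)
  rw [Finset.prod_ite_mem, Finset.univ_inter, Finset.prod_const] at h3
  rw [← h3]
  change _ = Matrix.det (I.piecewise (fun i j => ρ * A i j) fun i j => B i j)
  congr 1
  ext i j
  by_cases hi : i ∈ I <;> simp [hi, Finset.piecewise]

/-- The source identity divided by `∏ [x_i - z_j] [x_i - z_j + c]`, which is the form in which the
Cauchy determinants of the variables translated along `I` appear. -/
lemma source_identity_aux {φ : ℂ → ℂ} (hφ : Differentiable ℂ φ) (hφ0 : φ ≠ 0)
    (hH : HirotaRelation φ) {n : ℕ} (x z : Fin n → ℂ) (c : ℂ)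
    (hx : ∀ i j, i ≠ j → φ (x i - x j) ≠ 0) (hz : ∀ i j, i ≠ j → φ (z i - z j) ≠ 0)
    (hxz : ∀ i j, φ (x i - z j) ≠ 0) (hxzc : ∀ i j, φ (x i - z j + c) ≠ 0) :
    ∑ I : Finset (Fin n), (-1) ^ I.card * φ (∑ i, (x i - z i) + I.card * c) *
      (∏ i ∈ I, ∏ j ∈ Iᶜ, φ (x i - x j + c) / φ (x i - x j)) /
      ∏ i, ∏ j, φ (x i + (if i ∈ I then c else 0) - z j) = 0 := by
  have hc := hφ.continuous
  have hodd := hH.map_neg hφ hφ0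
  obtain ⟨p, hp, hpc⟩ := ((eventually_ne_zero hφ hφ0 0).and
    (eventually_add_ne_zero hφ hφ0 (-c) 0)).exists
  rw [← sub_eq_add_neg] at hpc
  set ρ : ℂ → ℂ := fun t => -(φ (p - c) * φ (p - t) / (φ p * φ (p - c - t))) with hρ
  set h : ℂ → Matrix (Fin n) (Fin n) ℂ := fun t => Matrix.of fun i j =>
    (-(φ c * φ (x i - z j + p) * φ (x i - z j - p + c + t)) /
      (φ p * φ (p - c - t) * (φ (x i - z j) * φ (x i - z j + c)))) with hh
  set Q : Finset (Fin n) → ℂ := fun I => ∏ i, ∏ j, φ (x i + (if i ∈ I then c else 0) - z j) with hQ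
  set R : Finset (Fin n) → ℂ := fun I => ∏ i ∈ I, ∏ j ∈ Iᶜ, φ (x i - x j + c) / φ (x i - x j)
    with hR
  set V : ℂ := ∏ i, ∏ j ∈ Finset.Ioi i, φ (x i - x j) * φ (z j - z i) with hV
  have hxI : ∀ (I : Finset (Fin n)) i j, φ (x i + (if i ∈ I then c else 0) - z j) ≠ 0 := by
    intro I i j
    split_ifs
    · rw [add_sub_right_comm]; exact hxzc i j
    · rw [add_zero]; exact hxz i j
  have hQ0 : ∀ I, Q I ≠ 0 := fun I =>
    Finset.prod_ne_zero_iff.mpr fun i _ => Finset.prod_ne_zero_iff.mpr fun j _ => hxI I i j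
  have hV0 : V ≠ 0 := Finset.prod_ne_zero_iff.mpr fun i _ => Finset.prod_ne_zero_iff.mpr
    fun j hj => mul_ne_zero (hx i j (Finset.mem_Ioi.mp hj).ne) (hz j i (Finset.mem_Ioi.mp hj).ne')
  -- Frobenius' determinant for the variables translated along `I`
  have hfrob : ∀ (I : Finset (Fin n)) (t : ℂ), φ t * (Matrix.of fun i j => if i ∈ I then
      φ (x i - z j + c + t) / φ (x i - z j + c) else φ (x i - z j + t) / φ (x i - z j)).det =
      φ t ^ n * (V * (φ (t + (∑ i, (x i - z i) + I.card * c)) * R I / Q I)) := by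
    intro I t
    have h1 := frobenius_det hφ hφ0 hH n (fun i => x i + if i ∈ I then c else 0) z (hxI I) t
    have hsum : ∑ i, (x i + (if i ∈ I then c else 0) - z i) =
        ∑ i, (x i - z i) + I.card * c := by
      simp_rw [add_sub_right_comm]
      rw [Finset.sum_add_distrib, Finset.sum_ite_mem, Finset.univ_inter, Finset.sum_const,
        nsmul_eq_mul]
    have hvan : (∏ i, ∏ j ∈ Finset.Ioi i, φ ((x i + if i ∈ I then c else 0) -
        (x j + if j ∈ I then c else 0)) * φ (z j - z i)) = V * R I := by
      have h2 := vandermonde_shift hodd x c I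
      have h3 : ∏ i ∈ I, ∏ j ∈ Iᶜ, φ (x i - x j) ≠ 0 :=
        Finset.prod_ne_zero_iff.mpr fun i hi => Finset.prod_ne_zero_iff.mpr fun j hj =>
          hx i j fun hij => by subst hij; exact Finset.mem_compl.mp hj hi
      simp only [hV, hR, Finset.prod_div_distrib, Finset.prod_mul_distrib]
      field_simp
      linear_combination (∏ i, ∏ j ∈ Finset.Ioi i, φ (z j - z i)) * h2
    rw [hsum, hvan] at h1
    have hmat : (Matrix.of fun i j => if i ∈ I then
      φ (x i - z j + c + t) / φ (x i - z j + c) else φ (x i - z j + t) / φ (x i - z j)) =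
      (Matrix.of fun i j => φ ((x i + if i ∈ I then c else 0) - z j + t) /
        φ ((x i + if i ∈ I then c else 0) - z j)) := by
      ext i j
      by_cases hi : i ∈ I
      · simp only [Matrix.of_apply, hi, if_true, add_sub_right_comm]
      · simp only [Matrix.of_apply, hi, if_false, add_zero]
    rw [hmat]
    have hQI := hQ0 I
    field_simp
    linear_combination h1
  have hρc : ContinuousAt ρ 0 := by
    refine ContinuousAt.neg (ContinuousAt.div ?_ ?_ ?_)
    · exact Continuous.continuousAt (by fun_prop)
    · exact Continuous.continuousAt (by fun_prop)
    · simpa using ⟨hp, hpc⟩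
  -- both sides are continuous at `t = 0`, and agree nearby after division by `[t] ^ n`
  have key := eq_of_eventually_eq_punctured (t₀ := 0)
    (f := fun t => V * ∑ I : Finset (Fin n),
      ρ t ^ I.card * (φ (t + (∑ i, (x i - z i) + I.card * c)) * R I / Q I))
    (g := fun t => φ t * (h t).det) ?_ ?_ ?_
  · simp only [hH.map_zero, zero_mul, zero_add] at key
    have hρ0 : ρ 0 = -1 := by
      simp only [hρ, sub_zero]
      rw [mul_comm, div_self (mul_ne_zero hp hpc)]
    rw [hρ0] at key
    refine Eq.trans ?_ ((mul_eq_zero.mp key).resolve_left hV0)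
    exact Finset.sum_congr rfl fun I _ => by rw [mul_assoc, mul_div_assoc]
  · refine continuousAt_const.mul (tendsto_finsetSum _ fun I _ => ?_)
    refine (hρc.pow _).mul (Continuous.continuousAt ?_)
    fun_prop
  · refine hc.continuousAt.mul ?_
    have : ContinuousAt h 0 := by
      refine continuousAt_pi.mpr fun i => continuousAt_pi.mpr fun j => ?_
      refine ContinuousAt.div ?_ ?_ ?_
      · exact Continuous.continuousAt (by fun_prop)
      · exact Continuous.continuousAt (by fun_prop)
      · simpa using ⟨⟨hp, hpc⟩, hxz i j, hxzc i j⟩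
    exact (Continuous.matrix_det continuous_id).continuousAt.comp this
  · have hpt : ∀ᶠ t in 𝓝[≠] (0 : ℂ), φ (p - c - t) ≠ 0 := by
      have hct : ContinuousAt (fun t : ℂ => φ (p - c - t)) 0 :=
        Continuous.continuousAt (by fun_prop)
      exact (hct.eventually_ne (by simpa using hpc)).filter_mono nhdsWithin_le_nhds
    filter_upwards [eventually_ne_zero hφ hφ0 0, hpt] with t ht hpt
    have h1 := sum_weighted_det (Matrix.of fun i j => φ (x i - z j + c + t) / φ (x i - z j + c))
      (Matrix.of fun i j => φ (x i - z j + t) / φ (x i - z j)) (ρ t)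
    have h2 : (Matrix.of fun i j => ρ t *
        (Matrix.of fun i j => φ (x i - z j + c + t) / φ (x i - z j + c)) i j +
        (Matrix.of fun i j => φ (x i - z j + t) / φ (x i - z j)) i j) = φ t • h t := by
      ext i j
      simp only [Matrix.of_apply, Matrix.smul_apply, smul_eq_mul, hh, hρ]
      exact hH.two_point hφ hφ0 hp hpt (hxz i j) (hxzc i j)
    rw [h2, Matrix.det_smul, Fintype.card_fin] at h1
    refine mul_left_cancel₀ (pow_ne_zero n ht) ?_
    calc φ t ^ n * (V * ∑ I : Finset (Fin n),
          ρ t ^ I.card * (φ (t + (∑ i, (x i - z i) + I.card * c)) * R I / Q I))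
        = φ t * ∑ I : Finset (Fin n), ρ t ^ I.card * (Matrix.of fun i j => if i ∈ I then
          φ (x i - z j + c + t) / φ (x i - z j + c) else
          φ (x i - z j + t) / φ (x i - z j)).det := by
          rw [← mul_assoc, Finset.mul_sum, Finset.mul_sum]
          refine Finset.sum_congr rfl fun I _ => ?_
          rw [mul_left_comm (φ t), hfrob I t]
          ring
      _ = φ t ^ n * (φ t * (h t).det) := by
          simp only [Matrix.of_apply] at h1
          rw [h1]; ring

/-- The source identity for `S = Fin n`. Here `[x_i - z_j + c₀]` may vanish, so that the case where
`c₀` is special is a limit of the generic one. -/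
theorem source_identity_fin {φ : ℂ → ℂ} (hφ : Differentiable ℂ φ) (hφ0 : φ ≠ 0)
    (hH : HirotaRelation φ) {n : ℕ} (x z : Fin n → ℂ) (c₀ : ℂ)
    (hx : ∀ i j, i ≠ j → φ (x i - x j) ≠ 0) (hz : ∀ i j, i ≠ j → φ (z i - z j) ≠ 0)
    (hxz : ∀ i j, φ (x i - z j) ≠ 0) :
    ∑ I : Finset (Fin n), (-1) ^ I.card * φ (∑ i, (x i - z i) + I.card * c₀) *
      (∏ i ∈ I, ∏ j ∈ Iᶜ, φ (x i - x j + c₀) / φ (x i - x j)) *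
      ((∏ i ∈ I, ∏ j, φ (x i - z j)) * ∏ i ∈ Iᶜ, ∏ j, φ (x i - z j + c₀)) = 0 := by
  have hc := hφ.continuous
  refine eq_of_eventually_eq_punctured (t₀ := c₀)
    (f := fun c => ∑ I : Finset (Fin n), (-1) ^ I.card * φ (∑ i, (x i - z i) + I.card * c) *
      (∏ i ∈ I, ∏ j ∈ Iᶜ, φ (x i - x j + c) / φ (x i - x j)) *
      ((∏ i ∈ I, ∏ j, φ (x i - z j)) * ∏ i ∈ Iᶜ, ∏ j, φ (x i - z j + c)))
    (g := fun _ => 0) ?_ continuousAt_const ?_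
  · exact Continuous.continuousAt (by fun_prop)
  have hev : ∀ᶠ c in 𝓝[≠] c₀, ∀ i j, φ (x i - z j + c) ≠ 0 := by
    refine eventually_all.mpr fun i => eventually_all.mpr fun j => ?_
    filter_upwards [eventually_add_ne_zero hφ hφ0 (x i - z j) c₀] with c h
    rwa [add_comm]
  filter_upwards [hev] with c hxzc
  have h := source_identity_aux hφ hφ0 hH x z c hx hz hxz hxzc
  have h' := congrArg
    (fun w => w * ((∏ i, ∏ j, φ (x i - z j)) * ∏ i, ∏ j, φ (x i - z j + c))) h
  simp only [zero_mul, Finset.sum_mul] at h'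
  rw [← h']
  refine Finset.sum_congr rfl fun I _ => ?_
  have hP : ∀ i, ∏ j, φ (x i - z j) ≠ 0 := fun i => Finset.prod_ne_zero_iff.mpr fun j _ => hxz i j
  have hPc : ∀ i, ∏ j, φ (x i - z j + c) ≠ 0 := fun i =>
    Finset.prod_ne_zero_iff.mpr fun j _ => hxzc i j
  have hQ : ∏ i, ∏ j, φ (x i + (if i ∈ I then c else 0) - z j) =
      (∏ i ∈ I, ∏ j, φ (x i - z j + c)) * ∏ i ∈ Iᶜ, ∏ j, φ (x i - z j) := by
    rw [← Finset.prod_mul_prod_compl I]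
    congr 1
    · exact Finset.prod_congr rfl fun i hi => by simp [hi, add_sub_right_comm]
    · exact Finset.prod_congr rfl fun i hi => by simp [Finset.mem_compl.mp hi]
  rw [hQ, ← Finset.prod_mul_prod_compl I fun i => ∏ j, φ (x i - z j),
    ← Finset.prod_mul_prod_compl I fun i => ∏ j, φ (x i - z j + c)]
  have h1 : ∏ i ∈ I, ∏ j, φ (x i - z j + c) ≠ 0 := Finset.prod_ne_zero_iff.mpr fun i _ => hPc i
  have h2 : ∏ i ∈ Iᶜ, ∏ j, φ (x i - z j) ≠ 0 := Finset.prod_ne_zero_iff.mpr fun i _ => hP i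
  generalize (∏ i ∈ I, ∏ j ∈ Iᶜ, φ (x i - x j + c) / φ (x i - x j)) = R
  field_simp

/-- The identity behind the relation between the `D_r` and the `H_s`. -/
theorem source_identity {φ : ℂ → ℂ} (hφ : Differentiable ℂ φ) (hφ0 : φ ≠ 0)
    (hH : HirotaRelation φ) {α : Type*} [DecidableEq α] (S : Finset α) (x z : α → ℂ) (c : ℂ)
    (hx : ∀ i ∈ S, ∀ j ∈ S, i ≠ j → φ (x i - x j) ≠ 0)
    (hz : ∀ i ∈ S, ∀ j ∈ S, i ≠ j → φ (z i - z j) ≠ 0)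
    (hxz : ∀ i ∈ S, ∀ j ∈ S, φ (x i - z j) ≠ 0) :
    ∑ I ∈ S.powerset, (-1) ^ I.card * φ (∑ i ∈ S, (x i - z i) + I.card * c) *
      (∏ i ∈ I, ∏ j ∈ S \ I, φ (x i - x j + c) / φ (x i - x j)) *
      ((∏ i ∈ I, ∏ j ∈ S, φ (x i - z j)) * ∏ i ∈ S \ I, ∏ j ∈ S, φ (x i - z j + c)) = 0 := by
  obtain ⟨m, e, rfl⟩ : ∃ (m : ℕ) (e : Fin m ↪ α), S = Finset.univ.map e := by
    refine ⟨S.card, S.equivFin.symm.toEmbedding.trans (Function.Embedding.subtype _), ?_⟩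
    rw [← Finset.map_map, Finset.map_univ_equiv]
    exact S.attach_map_val.symm
  have hmem : ∀ i, e i ∈ Finset.univ.map e := fun i => by simp
  have h := source_identity_fin hφ hφ0 hH (fun i => x (e i)) (fun i => z (e i)) c
    (fun i j hij => hx _ (hmem i) _ (hmem j) (e.injective.ne hij))
    (fun i j hij => hz _ (hmem i) _ (hmem j) (e.injective.ne hij))
    (fun i j => hxz _ (hmem i) _ (hmem j))
  rw [← h]
  symm
  refine Finset.sum_bij (fun I _ => I.map e) (fun I _ => ?_) (fun I _ J _ hIJ => ?_)
    (fun J hJ => ?_) (fun I _ => ?_)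
  · exact Finset.mem_powerset.mpr (Finset.map_subset_map.mpr (Finset.subset_univ I))
  · exact Finset.map_injective e hIJ
  · obtain ⟨I, -, rfl⟩ := Finset.subset_map_iff.mp (Finset.mem_powerset.mp hJ)
    exact ⟨I, Finset.mem_univ _, rfl⟩
  · have hs : Finset.univ.map e \ I.map e = Iᶜ.map e := by
      rw [Finset.compl_eq_univ_sdiff, Finset.map_sdiff]
    simp only [hs, Finset.prod_map, Finset.sum_map, Finset.card_map]

/-! ### The coefficient of one shift, pointwise -/

/-- The coefficient of `∏_{i ∈ I} T_{x_i}^δ` in `D_r`, as a function with values in `ℂ`. -/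
noncomputable def coeffD (φ : ℂ → ℂ) {n : ℕ} (κ : ℂ) (I : Finset (Fin n)) (x : Fin n → ℂ) : ℂ :=
  ∏ i ∈ I, ∏ j ∈ Iᶜ, φ (x i - x j + κ) / φ (x i - x j + 0)

/-- The coefficient of `∏_i T_{x_i}^{μ_i δ}` in `H_l`, as a function with values in `ℂ`. -/
noncomputable def coeffH (φ : ℂ → ℂ) {n : ℕ} (δ κ : ℂ) (μ : Fin n → ℕ) (x : Fin n → ℂ) : ℂ :=
  (∏ i, ∏ j ∈ Finset.Ioi i, φ (x i - x j + ((μ i : ℂ) - (μ j : ℂ)) * δ) / φ (x i - x j + 0)) *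
    ∏ i, ∏ j, ∏ k ∈ Finset.range (μ i),
      φ (x i - x j + (κ + (k : ℂ) * δ)) / φ (x i - x j + (δ + (k : ℂ) * δ))

lemma prod_prod_eq_prod_ite {ι R : Type*} [Fintype ι] [DecidableEq ι] [CommMonoid R]
    (A B : Finset ι) (f : ι → ι → R) :
    ∏ i ∈ A, ∏ j ∈ B, f i j = ∏ i, ∏ j, if i ∈ A ∧ j ∈ B then f i j else 1 := by
  have h : ∀ i, ∏ j, (if i ∈ A ∧ j ∈ B then f i j else 1) =
      if i ∈ A then ∏ j ∈ B, f i j else 1 := by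
    intro i
    by_cases hi : i ∈ A
    · simp only [hi, true_and, if_true]
      rw [Finset.prod_ite_mem, Finset.univ_inter]
    · simp [hi]
  simp_rw [h]
  rw [Finset.prod_ite_mem, Finset.univ_inter]

/-- The products over `k` occurring in `H_{l - |I|}` after the shift along `I`, together with the
numerator of `D_I`: up to a factor independent of `I`, only brackets with shift `κ - δ` survive.
It serves for the numerators, and with `κ = δ` for the denominators. -/
lemma rising_product_shift (φ : ℂ → ℂ) {n : ℕ} (δ κ : ℂ) (lam : Fin n → ℕ)
    (S I : Finset (Fin n)) (hS : ∀ i, i ∈ S ↔ lam i ≠ 0) (hI : I ⊆ S) (x : Fin n → ℂ) :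
    (∏ i ∈ I, ∏ j ∈ Iᶜ, φ (x i - x j + κ)) *
        (∏ i, ∏ j, ∏ k ∈ Finset.range (lam i - if i ∈ I then 1 else 0),
          φ ((x i + if i ∈ I then δ else 0) - (x j + if j ∈ I then δ else 0) +
            (κ + (k : ℂ) * δ))) =
      (∏ i ∈ S, ∏ j, ∏ k ∈ Finset.range (lam i - 1), φ (x i - x j + (κ + (k : ℂ) * δ))) *
        (∏ i ∈ S, ∏ j ∈ Iᶜ, φ (x i - x j + (lam i * δ + (κ - δ)))) *
        ∏ i ∈ S \ I, ∏ j ∈ I, φ (x i - x j + (κ - δ)) := by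
  rw [prod_prod_eq_prod_ite I Iᶜ fun i j => φ (x i - x j + κ),
    prod_prod_eq_prod_ite S Finset.univ fun i j =>
      ∏ k ∈ Finset.range (lam i - 1), φ (x i - x j + (κ + (k : ℂ) * δ)),
    prod_prod_eq_prod_ite S Iᶜ fun i j => φ (x i - x j + (lam i * δ + (κ - δ))),
    prod_prod_eq_prod_ite (S \ I) I fun i j => φ (x i - x j + (κ - δ))]
  simp only [← Finset.prod_mul_distrib]
  refine Finset.prod_congr rfl fun i _ => Finset.prod_congr rfl fun j _ => ?_
  by_cases hiS : i ∈ S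
  · obtain ⟨m, hm⟩ := Nat.exists_eq_succ_of_ne_zero ((hS i).mp hiS)
    by_cases hi : i ∈ I <;> by_cases hj : j ∈ I <;>
      simp only [hi, hj, hiS, hm, Finset.mem_compl, Finset.mem_sdiff, Finset.mem_univ, and_true,
        and_false, not_true, not_false_iff, if_true, if_false, mul_one, one_mul,
        add_zero, Nat.succ_eq_add_one, Nat.add_sub_cancel, Nat.sub_zero, add_sub_add_right_eq_sub]
    · have h := Finset.prod_range_succ' (fun k : ℕ => φ (x i - x j + (κ + (k : ℂ) * δ))) m
      rw [Finset.prod_range_succ] at h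
      push_cast at h
      rw [zero_mul, add_zero] at h
      rw [show x i - x j + (((m + 1 : ℕ) : ℂ) * δ + (κ - δ)) = x i - x j + (κ + m * δ) by
        push_cast; ring, h, mul_comm]
      congr 1
      refine Finset.prod_congr rfl fun k _ => ?_
      congr 1
      ring
    · rw [Finset.prod_range_succ']
      congr 1
      · refine Finset.prod_congr rfl fun k _ => ?_
        congr 1
        push_cast
        ring
      · congr 1
        push_cast
        ring
    · rw [Finset.prod_range_succ]
      congr 2
      push_cast
      ring
  · have hi : i ∉ I := fun h => hiS (hI h)
    have hm : lam i = 0 := by_contra fun h => hiS ((hS i).mpr h)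
    simp [hi, hiS, hm]

/-- The vanishing of the coefficient of `∏_i T_{x_i}^{λ_i δ}`, at a point of `ℂⁿ` where no
denominator vanishes. -/
theorem coefficient_identity {φ : ℂ → ℂ} (hφ : Differentiable ℂ φ) (hφ0 : φ ≠ 0)
    (hH : HirotaRelation φ) {n : ℕ} (δ κ : ℂ) (l : ℕ)
    (hδ : ∀ m : ℕ, 1 ≤ m → m ≤ l → φ ((m : ℂ) * δ) ≠ 0) (lam : Fin n → ℕ)
    (hlam : ∑ i, lam i = l) (x : Fin n → ℂ)
    (hx : ∀ i j, i ≠ j → ∀ k : ℤ, |k| ≤ l → φ (x i - x j + k * δ) ≠ 0) :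
    ∑ I ∈ (Finset.univ.filter fun i => lam i ≠ 0).powerset,
      ((-1) ^ I.card * φ ((I.card : ℂ) * κ + ((l : ℂ) - I.card) * δ)) *
        (coeffD φ κ I x * coeffH φ δ κ (fun i => lam i - if i ∈ I then 1 else 0)
          (fun i => x i + if i ∈ I then δ else 0)) = 0 := by
  set S : Finset (Fin n) := Finset.univ.filter fun i => lam i ≠ 0 with hSdef
  have hS : ∀ i, i ∈ S ↔ lam i ≠ 0 := fun i => by simp [hSdef]
  have hodd := hH.map_neg hφ hφ0
  have hle : ∀ i, lam i ≤ l := fun i => hlam ▸ Finset.single_le_sum (fun _ _ => Nat.zero_le _)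
    (Finset.mem_univ i)
  have hx0 : ∀ i j, i ≠ j → φ (x i - x j) ≠ 0 := fun i j hij => by
    have := hx i j hij 0 (by simp)
    simpa using this
  have hxm : ∀ i j (m : ℕ), 1 ≤ m → m ≤ l → φ (x i - x j + m * δ) ≠ 0 := by
    intro i j m h1 h2
    by_cases hij : i = j
    · subst hij
      rw [sub_self, zero_add]
      exact hδ m h1 h2
    · have := hx i j hij m (by rw [abs_of_nonneg (by positivity)]; exact_mod_cast h2)
      simpa using this
  have hxI : ∀ I : Finset (Fin n), ∏ i ∈ I, ∏ j ∈ Iᶜ, φ (x i - x j) ≠ 0 := fun I =>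
    Finset.prod_ne_zero_iff.mpr fun i hi => Finset.prod_ne_zero_iff.mpr fun j hj =>
      hx0 i j fun hij => by subst hij; exact Finset.mem_compl.mp hj hi
  -- the factors of the coefficients that do not depend on `I`
  set Z := ∏ i, ∏ j ∈ Finset.Ioi i, φ (x i - x j + ((lam i : ℂ) - lam j) * δ) with hZ
  set P := ∏ i, ∏ j ∈ Finset.Ioi i, φ (x i - x j) with hP
  set E : ℂ → ℂ := fun a => ∏ i ∈ S, ∏ j, ∏ k ∈ Finset.range (lam i - 1),
    φ (x i - x j + (a + (k : ℂ) * δ)) with hE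
  have hP0 : P ≠ 0 := Finset.prod_ne_zero_iff.mpr fun i _ => Finset.prod_ne_zero_iff.mpr
    fun j hj => hx0 i j (Finset.mem_Ioi.mp hj).ne
  have hE0 : E δ ≠ 0 := Finset.prod_ne_zero_iff.mpr fun i _ => Finset.prod_ne_zero_iff.mpr
    fun j _ => Finset.prod_ne_zero_iff.mpr fun k hk => by
      have := hxm i j (k + 1) (by omega) (by have := hle i; have := Finset.mem_range.mp hk; omega)
      rwa [show δ + (k : ℂ) * δ = ((k + 1 : ℕ) : ℂ) * δ by push_cast; ring]
  have he0 : ∀ i ∈ S, ∀ j, φ (x i - x j + (lam i * δ + (δ - δ))) ≠ 0 := fun i hi j => by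
    have := hxm i j (lam i) (Nat.one_le_iff_ne_zero.mpr ((hS i).mp hi)) (hle i)
    rwa [sub_self, add_zero]
  set F := ∏ i ∈ S, ∏ j, φ (x i - x j + (lam i * δ + (δ - δ))) with hF
  set b := ∏ i ∈ S, ∏ j ∈ Sᶜ, φ (x i - x j + (lam i * δ + (κ - δ))) with hb
  -- the source identity for the points `-x_i` and `-(x_i + λ_i δ)`, with `c = κ - δ`
  have hsrc := source_identity hφ hφ0 hH S (fun i => -x i) (fun i => -(x i + lam i * δ)) (κ - δ)
    (fun i _ j _ hij => by
      have := hx0 j i hij.symm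
      rwa [show -x i - -x j = x j - x i by ring])
    (fun i _ j _ hij => by
      have := hx j i hij.symm ((lam j : ℤ) - lam i) (by
        have := hle i; have := hle j; rw [abs_le]; omega)
      push_cast at this
      rwa [show -(x i + lam i * δ) - -(x j + lam j * δ) = x j - x i + ((lam j : ℂ) - lam i) * δ by
        ring])
    (fun i _ j hj => by
      have := he0 j hj i
      rwa [show -x i - -(x j + lam j * δ) = x j - x i + (lam j * δ + (δ - δ)) by ring])
  have hsrc' := congrArg (fun w => Z * E κ * b / (P * E δ * F) * w) hsrc
  simp only [mul_zero, Finset.mul_sum] at hsrc'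
  refine Eq.trans ?_ hsrc'
  refine Finset.sum_congr rfl fun I hI => ?_
  have hIS := Finset.mem_powerset.mp hI
  have hsum : ∑ i ∈ S, (-x i - -(x i + lam i * δ)) = l * δ := by
    have : ∀ i, -x i - -(x i + lam i * δ) = lam i * δ := fun i => by ring
    simp_rw [this]
    rw [← Finset.sum_mul, ← hlam, Nat.cast_sum]
    congr 1
    refine Finset.sum_subset (Finset.subset_univ _) fun i _ hi => ?_
    rw [not_not.mp (mt (hS i).mpr hi), Nat.cast_zero]
  have hN := rising_product_shift φ δ κ lam S I hS hIS x
  have hD := rising_product_shift φ δ δ lam S I hS hIS x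
  have hV := vandermonde_shift hodd x δ I
  have ha : ∏ i ∈ S, ∏ j ∈ Iᶜ, φ (x i - x j + (lam i * δ + (κ - δ))) =
      (∏ i ∈ S \ I, ∏ j ∈ S, φ (-x i - -(x j + lam j * δ) + (κ - δ))) * b := by
    rw [hb, Finset.prod_comm, Finset.prod_comm (s := S) (t := Sᶜ),
      show Iᶜ = (S \ I) ∪ Sᶜ by
        ext i
        have := @hIS i
        simp only [Finset.mem_compl, Finset.mem_union, Finset.mem_sdiff]
        tauto,
      Finset.prod_union (Finset.disjoint_left.mpr fun i h1 h2 =>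
        Finset.mem_compl.mp h2 (Finset.mem_sdiff.mp h1).1)]
    congr 1
    refine Finset.prod_congr rfl fun i _ => Finset.prod_congr rfl fun j _ => ?_
    congr 1
    ring
  -- the denominators `[z_i - x_j]` with `j ∉ I` are `F` divided by the numerators with `j ∈ I`
  have hg : (∏ i ∈ S, ∏ j ∈ Iᶜ, φ (x i - x j + (lam i * δ + (δ - δ)))) *
      (∏ i ∈ I, ∏ j ∈ S, φ (-x i - -(x j + lam j * δ))) = F := by
    rw [hF, Finset.prod_comm, Finset.prod_comm (s := S) (t := Finset.univ), mul_comm,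
      ← Finset.prod_mul_prod_compl I]
    congr 1
    refine Finset.prod_congr rfl fun i _ => Finset.prod_congr rfl fun j _ => ?_
    congr 1
    ring
  have hu : (∏ i ∈ I, ∏ j ∈ S \ I, φ (-x i - -x j + (κ - δ)) / φ (-x i - -x j)) =
      (∏ i ∈ S \ I, ∏ j ∈ I, φ (x i - x j + (κ - δ))) /
        ∏ i ∈ S \ I, ∏ j ∈ I, φ (x i - x j + (δ - δ)) := by
    simp only [← Finset.prod_div_distrib]
    rw [Finset.prod_comm]
    refine Finset.prod_congr rfl fun i _ => Finset.prod_congr rfl fun j _ => ?_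
    rw [show -x j - -x i = x i - x j by ring, sub_self, add_zero]
  have hu0 : ∏ i ∈ S \ I, ∏ j ∈ I, φ (x i - x j + (δ - δ)) ≠ 0 :=
    Finset.prod_ne_zero_iff.mpr fun i hi => Finset.prod_ne_zero_iff.mpr fun j hj => by
      rw [sub_self, add_zero]
      exact hx0 i j fun hij => (Finset.mem_sdiff.mp hi).2 (hij ▸ hj)
  have hg0 : F ≠ 0 := Finset.prod_ne_zero_iff.mpr fun i hi => Finset.prod_ne_zero_iff.mpr
    fun j _ => he0 i hi j
  have hcD : coeffD φ κ I x = (∏ i ∈ I, ∏ j ∈ Iᶜ, φ (x i - x j + κ)) /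
      ∏ i ∈ I, ∏ j ∈ Iᶜ, φ (x i - x j) := by
    simp only [coeffD, add_zero, Finset.prod_div_distrib]
  have hcH : coeffH φ δ κ (fun i => lam i - if i ∈ I then 1 else 0)
      (fun i => x i + if i ∈ I then δ else 0) = Z /
      (∏ i, ∏ j ∈ Finset.Ioi i,
        φ ((x i + if i ∈ I then δ else 0) - (x j + if j ∈ I then δ else 0))) *
      ((∏ i, ∏ j, ∏ k ∈ Finset.range (lam i - if i ∈ I then 1 else 0),
          φ ((x i + if i ∈ I then δ else 0) - (x j + if j ∈ I then δ else 0) +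
            (κ + (k : ℂ) * δ))) /
        (∏ i, ∏ j, ∏ k ∈ Finset.range (lam i - if i ∈ I then 1 else 0),
          φ ((x i + if i ∈ I then δ else 0) - (x j + if j ∈ I then δ else 0) +
            (δ + (k : ℂ) * δ)))) := by
    simp only [coeffH, add_zero, Finset.prod_div_distrib]
    congr 2
    refine Finset.prod_congr rfl fun i _ => Finset.prod_congr rfl fun j _ => ?_
    have hcast : ∀ i, ((lam i - (if i ∈ I then 1 else 0) : ℕ) : ℂ) * δ =
        lam i * δ - if i ∈ I then δ else 0 := by
      intro i
      split_ifs with hi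
      · rw [Nat.cast_sub (Nat.one_le_iff_ne_zero.mpr ((hS i).mp (hIS hi)))]
        push_cast
        ring
      · simp
    congr 1
    rw [sub_mul, hcast, hcast]
    ring
  -- what is left is algebra in these products; `N` may vanish, so nothing is divided by it
  rw [hcD, hcH, hsum, hu, show (l : ℂ) * δ + I.card * (κ - δ) =
    (I.card : ℂ) * κ + ((l : ℂ) - I.card) * δ by ring]
  rw [ha] at hN
  rw [← hg] at hg0 ⊢
  have hY := hxI I
  change _ = E κ * _ * _ at hN
  change _ = E δ * _ * _ at hD
  generalize (∏ i ∈ S \ I, ∏ j ∈ I, φ (x i - x j + (κ - δ))) = u at *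
  generalize (∏ i ∈ S \ I, ∏ j ∈ I, φ (x i - x j + (δ - δ))) = u' at *
  generalize (∏ i ∈ I, ∏ j ∈ Iᶜ, φ (x i - x j + κ)) = A at *
  generalize (∏ i ∈ I, ∏ j ∈ Iᶜ, φ (x i - x j + δ)) = Y at *
  generalize (∏ i ∈ I, ∏ j ∈ Iᶜ, φ (x i - x j)) = X at *
  generalize (∏ i ∈ S, ∏ j ∈ Iᶜ, φ (x i - x j + (lam i * δ + (δ - δ)))) = e' at *
  generalize (∏ i ∈ I, ∏ j ∈ S, φ (-x i - -(x j + lam j * δ))) = g at *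
  generalize (∏ i ∈ S \ I, ∏ j ∈ S, φ (-x i - -(x j + lam j * δ) + (κ - δ))) = a at *
  generalize (∏ i, ∏ j ∈ Finset.Ioi i,
        φ ((x i + if i ∈ I then δ else 0) - (x j + if j ∈ I then δ else 0))) = Py at *
  generalize (∏ i, ∏ j, ∏ k ∈ Finset.range (lam i - if i ∈ I then 1 else 0),
          φ ((x i + if i ∈ I then δ else 0) - (x j + if j ∈ I then δ else 0) +
            (κ + (k : ℂ) * δ))) = N at *
  generalize (∏ i, ∏ j, ∏ k ∈ Finset.range (lam i - if i ∈ I then 1 else 0),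
          φ ((x i + if i ∈ I then δ else 0) - (x j + if j ∈ I then δ else 0) +
            (δ + (k : ℂ) * δ))) = D at *
  generalize E κ = Eκ at *
  generalize E δ = Eδ at *
  obtain ⟨he'0, hg'0⟩ := mul_ne_zero_iff.mp hg0
  have hYD : Y ≠ 0 ∧ D ≠ 0 := mul_ne_zero_iff.mp (hD ▸ mul_ne_zero (mul_ne_zero hE0 he'0) hu0)
  have hPy : Py ≠ 0 := left_ne_zero_of_mul (hV ▸ mul_ne_zero hP0 hYD.1)
  calc _ = ((-1) ^ I.card * φ ((I.card : ℂ) * κ + ((l : ℂ) - I.card) * δ)) *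
        (Z * (A * N) / ((Py * X) * D)) := by
        congr 1; rw [div_mul_div_comm, div_mul_div_comm]; congr 1 <;> ring
    _ = ((-1) ^ I.card * φ ((I.card : ℂ) * κ + ((l : ℂ) - I.card) * δ)) *
        (Z * (Eκ * (a * b) * u) / (P * (Eδ * e' * u'))) := by rw [hN, hV, mul_assoc P, hD]
    _ = _ := by field_simp

/-! ### From pointwise identities to meromorphic functions -/

/-- `Represents m f` says that off the zero set of some nonzero entire function `b` the meromorphic
function `m` takes the values `f x`: `m = a / b` with `a` entire and `f x = a x / b x` wherever
`b x ≠ 0`. Nothing is required of `f` on the zero set of `b`. -/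
def Represents {n : ℕ} (m : Mero n) (f : (Fin n → ℂ) → ℂ) : Prop :=
  ∃ a b : Entire n, b ≠ 0 ∧ m * algebraMap (Entire n) (Mero n) b = algebraMap (Entire n) (Mero n) a ∧
    ∀ x, b.1 x ≠ 0 → f x * b.1 x = a.1 x

lemma algebraMap_mero_ne_zero {n : ℕ} {e : Entire n} (he : e ≠ 0) :
    algebraMap (Entire n) (Mero n) e ≠ 0 :=
  (map_ne_zero_iff _ (IsFractionRing.injective _ _)).mpr he

namespace Represents
variable {n : ℕ} {m m' : Mero n} {f g : (Fin n → ℂ) → ℂ}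

lemma algebraMap_entire (a : Entire n) : Represents (algebraMap (Entire n) (Mero n) a) a.1 :=
  ⟨a, 1, one_ne_zero, by simp, fun x _ => mul_one _⟩

lemma const (c : ℂ) : Represents (algebraMap ℂ (Mero n) c) fun _ => c := by
  rw [IsScalarTower.algebraMap_apply ℂ (Entire n) (Mero n)]
  exact algebraMap_entire _

lemma one : Represents (1 : Mero n) fun _ => 1 := by simpa using const (n := n) 1

lemma zero : Represents (0 : Mero n) fun _ => 0 := by simpa using const (n := n) 0

lemma add (h : Represents m f) (h' : Represents m' g) :
    Represents (m + m') fun x => f x + g x := by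
  obtain ⟨a, b, hb, hm, hf⟩ := h
  obtain ⟨a', b', hb', hm', hf'⟩ := h'
  refine ⟨a * b' + a' * b, b * b', mul_ne_zero hb hb', ?_, fun x hx => ?_⟩
  · simp only [map_add, map_mul, ← hm, ← hm']; ring
  · have hx' : b.1 x * b'.1 x ≠ 0 := hx
    obtain ⟨h1, h2⟩ := mul_ne_zero_iff.mp hx'
    change (f x + g x) * (b.1 x * b'.1 x) = a.1 x * b'.1 x + a'.1 x * b.1 x
    rw [← hf x h1, ← hf' x h2]; ring

lemma mul (h : Represents m f) (h' : Represents m' g) :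
    Represents (m * m') fun x => f x * g x := by
  obtain ⟨a, b, hb, hm, hf⟩ := h
  obtain ⟨a', b', hb', hm', hf'⟩ := h'
  refine ⟨a * a', b * b', mul_ne_zero hb hb', ?_, fun x hx => ?_⟩
  · simp only [map_mul, ← hm, ← hm']; ring
  · have hx' : b.1 x * b'.1 x ≠ 0 := hx
    obtain ⟨h1, h2⟩ := mul_ne_zero_iff.mp hx'
    change f x * g x * (b.1 x * b'.1 x) = a.1 x * a'.1 x
    rw [← hf x h1, ← hf' x h2]; ring

lemma inv (h : Represents m f) : Represents m⁻¹ fun x => (f x)⁻¹ := by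
  obtain ⟨a, b, hb, hm, hf⟩ := h
  have hb' : algebraMap (Entire n) (Mero n) b ≠ 0 := algebraMap_mero_ne_zero hb
  by_cases ha : a = 0
  · -- then `m = 0`, and `0⁻¹ = 0` on both sides
    have hm0 : m = 0 := by
      rw [ha, map_zero] at hm
      exact (mul_eq_zero.mp hm).resolve_right hb'
    refine ⟨0, b, hb, by simp [hm0], fun x hx => ?_⟩
    have h0 : f x * b.1 x = 0 := by rw [hf x hx, ha]; rfl
    simp only [(mul_eq_zero.mp h0).resolve_right hx, inv_zero, zero_mul]
    rfl
  · have ha' : algebraMap (Entire n) (Mero n) a ≠ 0 := algebraMap_mero_ne_zero ha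
    have hm0 : m ≠ 0 := fun h0 => ha' (by rw [← hm, h0, zero_mul])
    refine ⟨b * b, a * b, mul_ne_zero ha hb, ?_, fun x hx => ?_⟩
    · rw [map_mul, map_mul, ← hm]; field_simp
    · have hx' : a.1 x * b.1 x ≠ 0 := hx
      obtain ⟨h1, h2⟩ := mul_ne_zero_iff.mp hx'
      change (f x)⁻¹ * (a.1 x * b.1 x) = b.1 x * b.1 x
      have hfx : f x ≠ 0 := fun h0 => h1 (by rw [← hf x h2, h0, zero_mul])
      rw [← hf x h2]; field_simp

lemma div (h : Represents m f) (h' : Represents m' g) :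
    Represents (m / m') fun x => f x / g x := by
  simpa only [div_eq_mul_inv] using h.mul h'.inv

lemma prod {ι : Type*} (s : Finset ι) {m : ι → Mero n} {f : ι → (Fin n → ℂ) → ℂ}
    (h : ∀ i, Represents (m i) (f i)) :
    Represents (∏ i ∈ s, m i) fun x => ∏ i ∈ s, f i x := by
  classical
  induction s using Finset.induction_on with
  | empty => simpa using one
  | insert i s hi ih => simpa only [Finset.prod_insert hi] using (h i).mul ih

lemma sum {ι : Type*} (s : Finset ι) {m : ι → Mero n} {f : ι → (Fin n → ℂ) → ℂ}
    (h : ∀ i, Represents (m i) (f i)) :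
    Represents (∑ i ∈ s, m i) fun x => ∑ i ∈ s, f i x := by
  classical
  induction s using Finset.induction_on with
  | empty => simpa using zero
  | insert i s hi ih => simpa only [Finset.sum_insert hi] using (h i).add ih

lemma shift (h : Represents m f) (v : Fin n → ℂ) :
    Represents (RuijsenaarsWronski.shift v m) fun x => f (x + v) := by
  obtain ⟨a, b, hb, hm, hf⟩ := h
  refine ⟨shiftEntire v a, shiftEntire v b, by simpa using hb, ?_, fun x hx => hf (x + v) hx⟩
  have h1 : ∀ e : Entire n, algebraMap (Entire n) (Mero n) (shiftEntire v e) =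
      (IsFractionRing.algEquivOfAlgEquiv (shiftEntire v) : Mero n ≃ₐ[ℂ] Mero n)
        (algebraMap _ _ e) := fun e =>
    (IsFractionRing.algEquivOfAlgEquiv_algebraMap (shiftEntire v) e).symm
  rw [h1, h1, ← hm, map_mul]
  rfl

lemma eq_zero_of_forall {d : Entire n} (h : Represents m f) (hd : d ≠ 0)
    (hf0 : ∀ x, d.1 x ≠ 0 → f x = 0) : m = 0 := by
  obtain ⟨a, b, hb, hm, hf⟩ := h
  have hprod : a * (b * d) = 0 := by
    ext x
    change a.1 x * (b.1 x * d.1 x) = 0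
    by_cases hbx : b.1 x = 0
    · simp [hbx]
    by_cases hdx : d.1 x = 0
    · simp [hdx]
    rw [← hf x hbx, hf0 x hdx]; simp
  have ha := (mul_eq_zero.mp hprod).resolve_right (mul_ne_zero hb hd)
  rw [ha, map_zero] at hm
  exact (mul_eq_zero.mp hm).resolve_right (algebraMap_mero_ne_zero hb)

end Represents

lemma represents_bracket {φ : ℂ → ℂ} (hφ : Differentiable ℂ φ) {n : ℕ} (i j : Fin n) (c : ℂ) :
    Represents (bracket φ hφ i j c) fun x => φ (x i - x j + c) :=
  Represents.algebraMap_entire _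

/-- Off the zero set of some nonzero entire function, none of finitely many brackets
`[x_i - x_j + k δ]` with `i ≠ j` vanishes. -/
lemma exists_entire_avoiding {φ : ℂ → ℂ} (hφ : Differentiable ℂ φ) (hφ0 : φ ≠ 0) (n : ℕ) (δ : ℂ)
    (K : Finset ℤ) :
    ∃ d : Entire n, d ≠ 0 ∧ ∀ x, d.1 x ≠ 0 → ∀ i j, i ≠ j → ∀ k ∈ K,
      φ (x i - x j + k * δ) ≠ 0 := by
  have hb : ∀ i j : Fin n, i ≠ j → ∀ k : ℤ, ∃ d : Entire n, d ≠ 0 ∧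
      d.1 = fun x => φ (x i - x j + k * δ) := by
    intro i j hij k
    refine ⟨⟨fun x => φ (x i - x j + k * δ), fun x _ =>
      (hφ.analyticAt _).comp_of_eq ((((ContinuousLinearMap.proj i :
        (Fin n → ℂ) →L[ℂ] ℂ).analyticAt x).sub ((ContinuousLinearMap.proj j :
        (Fin n → ℂ) →L[ℂ] ℂ).analyticAt x)).add analyticAt_const) rfl⟩, fun h => ?_, rfl⟩
    obtain ⟨w, hw⟩ := Function.ne_iff.mp hφ0
    have h1 := congrFun (congrArg Subtype.val h) (Pi.single i (w - k * δ))
    change φ ((Pi.single i (w - k * δ) : Fin n → ℂ) i - (Pi.single i (w - k * δ) : Fin n → ℂ) j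
      + k * δ) = 0 at h1
    rw [Pi.single_eq_same, Pi.single_eq_of_ne hij.symm, sub_zero, sub_add_cancel] at h1
    exact hw h1
  have hd : ∀ p : (Fin n × Fin n) × ℤ, ∃ d : Entire n, d ≠ 0 ∧
      ∀ x, d.1 x ≠ 0 → p.1.1 ≠ p.1.2 → φ (x p.1.1 - x p.1.2 + p.2 * δ) ≠ 0 := by
    intro p
    by_cases hp : p.1.1 = p.1.2
    · exact ⟨1, one_ne_zero, fun _ _ h => absurd hp h⟩
    · obtain ⟨d, hd0, hd⟩ := hb _ _ hp p.2
      exact ⟨d, hd0, fun x hx _ => by rw [hd] at hx; exact hx⟩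
  choose d hd0 hd using hd
  refine ⟨∏ p ∈ Finset.univ ×ˢ K, d p, Finset.prod_ne_zero_iff.mpr fun p _ => hd0 p, ?_⟩
  intro x hx i j hij k hk
  refine hd ((i, j), k) x (fun h0 => hx ?_) hij
  obtain ⟨e, he⟩ := Finset.dvd_prod_of_mem d
    (show ((i, j), k) ∈ Finset.univ ×ˢ K from Finset.mem_product.mpr ⟨Finset.mem_univ _, hk⟩)
  rw [he]
  change (d ((i, j), k)).1 x * e.1 x = 0
  rw [h0, zero_mul]

/-! ### Products of difference operators -/

/-- The coefficient of `∏_{i ∈ I} T_{x_i}^δ` in `D_r`. -/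
noncomputable def meroCoeffD (φ : ℂ → ℂ) (hφ : Differentiable ℂ φ) {n : ℕ} (κ : ℂ)
    (I : Finset (Fin n)) : Mero n :=
  ∏ i ∈ I, ∏ j ∈ Iᶜ, bracket φ hφ i j κ / bracket φ hφ i j 0

/-- The coefficient of `∏_i T_{x_i}^{μ_i δ}` in `H_l`. -/
noncomputable def meroCoeffH (φ : ℂ → ℂ) (hφ : Differentiable ℂ φ) {n : ℕ} (δ κ : ℂ)
    (μ : Fin n → ℕ) : Mero n :=
  (∏ i : Fin n, ∏ j ∈ Finset.Ioi i,
      bracket φ hφ i j (((μ i : ℂ) - (μ j : ℂ)) * δ) / bracket φ hφ i j 0) *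
    ∏ i : Fin n, ∏ j : Fin n, ∏ k ∈ Finset.range (μ i),
      bracket φ hφ i j (κ + (k : ℂ) * δ) / bracket φ hφ i j (δ + (k : ℂ) * δ)

lemma represents_meroCoeffD {φ : ℂ → ℂ} (hφ : Differentiable ℂ φ) {n : ℕ} (κ : ℂ)
    (I : Finset (Fin n)) : Represents (meroCoeffD φ hφ κ I) (coeffD φ κ I) :=
  Represents.prod _ fun _ => Represents.prod _ fun _ =>
    (represents_bracket hφ _ _ _).div (represents_bracket hφ _ _ _)

lemma represents_meroCoeffH {φ : ℂ → ℂ} (hφ : Differentiable ℂ φ) {n : ℕ} (δ κ : ℂ)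
    (μ : Fin n → ℕ) : Represents (meroCoeffH φ hφ δ κ μ) (coeffH φ δ κ μ) :=
  (Represents.prod _ fun _ => Represents.prod _ fun _ =>
    (represents_bracket hφ _ _ _).div (represents_bracket hφ _ _ _)).mul
  (Represents.prod _ fun _ => Represents.prod _ fun _ => Represents.prod _ fun _ =>
    (represents_bracket hφ _ _ _).div (represents_bracket hφ _ _ _))

lemma shift_mul_apply {n : ℕ} (a : Fin n → ℂ) (f g : Mero n) :
    shift a (f * g) = shift a f * shift a g :=
  map_mul (IsFractionRing.algEquivOfAlgEquiv (shiftEntire a) : Mero n ≃ₐ[ℂ] Mero n) f g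

lemma shift_mul_shift {n : ℕ} (a b : Fin n → ℂ) : shift a * shift b = shift (a + b) := by
  refine LinearMap.ext fun m => ?_
  have hE : ∀ (v : Fin n → ℂ) (e : Entire n), shift v (algebraMap (Entire n) (Mero n) e) =
      algebraMap _ _ (shiftEntire v e) := fun v e =>
    IsFractionRing.algEquivOfAlgEquiv_algebraMap (shiftEntire v) e
  have hdiv : ∀ (v : Fin n → ℂ) (f g : Mero n), shift v (f / g) = shift v f / shift v g :=
    fun v f g =>
      map_div₀ (IsFractionRing.algEquivOfAlgEquiv (shiftEntire v) : Mero n ≃ₐ[ℂ] Mero n) f g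
  obtain ⟨e, d, -, rfl⟩ := IsFractionRing.div_surjective (A := Entire n) m
  have hs : ∀ e : Entire n, shiftEntire a (shiftEntire b e) = shiftEntire (a + b) e := by
    intro e
    ext x
    change e.1 (x + a + b) = e.1 (x + (a + b))
    rw [add_assoc]
  rw [Module.End.mul_apply, hdiv, hdiv, hdiv, hE, hE, hE, hE, hE, hE, hs, hs]

lemma mulLeft_shift_mul_mulLeft_shift {n : ℕ} (f g : Mero n) (a b : Fin n → ℂ) :
    (LinearMap.mulLeft ℂ f * shift a) * (LinearMap.mulLeft ℂ g * shift b) =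
      LinearMap.mulLeft ℂ (f * shift a g) * shift (a + b) := by
  rw [← shift_mul_shift]
  refine LinearMap.ext fun m => ?_
  simp only [Module.End.mul_apply, LinearMap.mulLeft_apply, shift_mul_apply, mul_assoc]

/-- The coefficient of `∏_i T_{x_i}^{λ_i δ}` in the operator of the theorem vanishes. -/
lemma mero_coefficient_identity {φ : ℂ → ℂ} (hφ : Differentiable ℂ φ) (hφ0 : φ ≠ 0)
    (hH : HirotaRelation φ) {n : ℕ} (δ κ : ℂ) (l : ℕ)
    (hδ : ∀ m : ℕ, 1 ≤ m → m ≤ l → φ ((m : ℂ) * δ) ≠ 0) (lam : Fin n → ℕ)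
    (hlam : ∑ i, lam i = l) :
    ∑ I ∈ (Finset.univ.filter fun i => lam i ≠ 0).powerset,
      ((-1) ^ I.card * φ ((I.card : ℂ) * κ + ((l : ℂ) - I.card) * δ)) •
        (meroCoeffD φ hφ κ I * shift (fun i => if i ∈ I then δ else 0)
          (meroCoeffH φ hφ δ κ (fun i => lam i - if i ∈ I then 1 else 0))) = 0 := by
  obtain ⟨d, hd, hdx⟩ := exists_entire_avoiding hφ hφ0 n δ (Finset.Icc (-(l : ℤ)) l)
  simp only [Algebra.smul_def]
  refine Represents.eq_zero_of_forall (Represents.sum _ fun I => (Represents.const _).mul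
    ((represents_meroCoeffD hφ κ I).mul ((represents_meroCoeffH hφ δ κ _).shift _))) hd
    fun x hx => ?_
  exact coefficient_identity hφ hφ0 hH δ κ l hδ lam hlam x fun i j hij k hk =>
    hdx x hx i j hij k (Finset.mem_Icc.mpr (abs_le.mp hk))

/-- Regrouping of a sum over `r + s = l`, `|I| = r`, `|μ| = s` by `λ = μ + 1_I`, the exponent of the
product of the shifts attached to `I` and `μ`. -/
lemma sum_regroup {M : Type*} [AddCommMonoid M] (n l : ℕ)
    (G : ℕ → ℕ → Finset (Fin n) → (Fin n → ℕ) → M) :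
    ∑ p ∈ Finset.HasAntidiagonal.antidiagonal l,
      ∑ I ∈ (Finset.univ : Finset (Fin n)).powersetCard p.1,
        ∑ μ ∈ Finset.piAntidiag (Finset.univ : Finset (Fin n)) p.2, G p.1 p.2 I μ =
    ∑ lam ∈ Finset.piAntidiag (Finset.univ : Finset (Fin n)) l,
      ∑ I ∈ (Finset.univ.filter fun i => lam i ≠ 0).powerset,
        G I.card (l - I.card) I (fun i => lam i - if i ∈ I then 1 else 0) := by
  have hcard : ∀ I : Finset (Fin n), ∑ i, (if i ∈ I then 1 else 0) = I.card := fun I => by simp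
  simp only [Finset.sum_sigma']
  refine Finset.sum_nbij'
    (i := fun q => ⟨fun i => q.2.2 i + if i ∈ q.2.1 then 1 else 0, q.2.1⟩)
    (j := fun q => ⟨(q.2.card, l - q.2.card), q.2, fun i => q.1 i - if i ∈ q.2 then 1 else 0⟩)
    ?_ ?_ ?_ ?_ ?_
  · rintro ⟨⟨r, s⟩, I, μ⟩ hq
    simp only [Finset.mem_sigma, Finset.HasAntidiagonal.mem_antidiagonal,
      Finset.mem_powersetCard, Finset.mem_piAntidiag] at hq
    obtain ⟨hrs, ⟨-, hI⟩, hμ, -⟩ := hq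
    simp only [Finset.mem_sigma, Finset.mem_piAntidiag, Finset.mem_powerset]
    refine ⟨⟨?_, fun _ _ => Finset.mem_univ _⟩, fun i hi => ?_⟩
    · have hμ' : ∑ i, μ i = s := hμ
      rw [Finset.sum_add_distrib, hcard]; omega
    · simp [hi]
  · rintro ⟨lam, I⟩ hq
    simp only [Finset.mem_sigma, Finset.mem_piAntidiag, Finset.mem_powerset] at hq
    obtain ⟨⟨hlam, -⟩, hI⟩ := hq
    have hle : ∀ i ∈ Finset.univ, (if i ∈ I then 1 else 0) ≤ lam i := by
      intro i _
      split_ifs with hi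
      · exact Nat.one_le_iff_ne_zero.mpr (Finset.mem_filter.mp (hI hi)).2
      · exact Nat.zero_le _
    have h1 := Finset.sum_le_sum hle
    rw [hcard, hlam] at h1
    simp only [Finset.mem_sigma, Finset.HasAntidiagonal.mem_antidiagonal,
      Finset.mem_powersetCard, Finset.mem_piAntidiag]
    refine ⟨Nat.add_sub_cancel' h1, ⟨Finset.subset_univ _, trivial⟩, ?_, fun _ _ => Finset.mem_univ _⟩
    rw [Finset.sum_tsub_distrib _ hle, hcard, hlam]
  · rintro ⟨⟨r, s⟩, I, μ⟩ hq
    simp only [Finset.mem_sigma, Finset.HasAntidiagonal.mem_antidiagonal,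
      Finset.mem_powersetCard, Finset.mem_piAntidiag] at hq
    obtain ⟨hrs, ⟨-, rfl⟩, -, -⟩ := hq
    obtain rfl : s = l - I.card := by omega
    simp
  · rintro ⟨lam, I⟩ hq
    simp only [Finset.mem_sigma, Finset.mem_piAntidiag, Finset.mem_powerset] at hq
    have : (fun i => lam i - (if i ∈ I then 1 else 0) + if i ∈ I then 1 else 0) = lam := by
      funext i
      split_ifs with hi
      · exact Nat.sub_add_cancel (Nat.one_le_iff_ne_zero.mpr (Finset.mem_filter.mp (hq.2 hi)).2)
      · rfl
    simp only [this]
  · rintro ⟨⟨r, s⟩, I, μ⟩ hq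
    simp only [Finset.mem_sigma, Finset.HasAntidiagonal.mem_antidiagonal,
      Finset.mem_powersetCard, Finset.mem_piAntidiag] at hq
    obtain ⟨hrs, ⟨-, rfl⟩, -, -⟩ := hq
    obtain rfl : s = l - I.card := by omega
    simp

end RuijsenaarsWronski

open RuijsenaarsWronski in
theorem theorem1p2 (φ : ℂ → ℂ) (hφ : Differentiable ℂ φ) (hφ0 : φ ≠ 0)
    (hH : RuijsenaarsWronski.HirotaRelation φ) (n : ℕ) (δ κ : ℂ) (l : ℕ) (hl : 1 ≤ l)
    (hδ : ∀ m : ℕ, 1 ≤ m → m ≤ l → φ ((m : ℂ) * δ) ≠ 0) :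
    ∑ p ∈ Finset.HasAntidiagonal.antidiagonal l,
      ((-1 : ℂ) ^ p.1 * φ ((p.1 : ℂ) * κ + (p.2 : ℂ) * δ)) •
        (RuijsenaarsWronski.opD φ hφ n δ κ p.1 * RuijsenaarsWronski.opH φ hφ n δ κ p.2) = 0 := by
  have hD : ∀ r, opD φ hφ n δ κ r = ∑ I ∈ (Finset.univ : Finset (Fin n)).powersetCard r,
      LinearMap.mulLeft ℂ (meroCoeffD φ hφ κ I) * shift (fun i => if i ∈ I then δ else 0) :=
    fun _ => rfl
  have hHl : ∀ s, opH φ hφ n δ κ s = ∑ μ ∈ Finset.piAntidiag (Finset.univ : Finset (Fin n)) s,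
      LinearMap.mulLeft ℂ (meroCoeffH φ hφ δ κ μ) * shift (fun i => (μ i : ℂ) * δ) :=
    fun _ => rfl
  simp only [hD, hHl, Finset.sum_mul_sum, mulLeft_shift_mul_mulLeft_shift, Finset.smul_sum]
  have hreg := sum_regroup n l fun r s I μ => ((-1 : ℂ) ^ r * φ ((r : ℂ) * κ + (s : ℂ) * δ)) •
    (LinearMap.mulLeft ℂ (meroCoeffD φ hφ κ I * shift (fun i => if i ∈ I then δ else 0)
      (meroCoeffH φ hφ δ κ μ)) *
      shift ((fun i => if i ∈ I then δ else 0) + fun i => (μ i : ℂ) * δ))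
  refine hreg.trans (Finset.sum_eq_zero fun lam hlam => ?_)
  have hsum := (Finset.mem_piAntidiag.mp hlam).1
  have hzero := mero_coefficient_identity hφ hφ0 hH δ κ l hδ lam hsum
  refine Eq.trans ?_ (congrArg (fun m => LinearMap.mulLeft ℂ m *
    shift fun i => (lam i : ℂ) * δ) hzero |>.trans (by simp))
  refine LinearMap.ext fun m => ?_
  simp only [LinearMap.sum_apply, Module.End.mul_apply, LinearMap.mulLeft_apply, Finset.sum_mul,
    LinearMap.smul_apply, smul_mul_assoc]
  refine Finset.sum_congr rfl fun I hI => ?_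
  have hI' : ∀ i ∈ I, 1 ≤ lam i := fun i hi => Nat.one_le_iff_ne_zero.mpr
    (Finset.mem_filter.mp (Finset.mem_powerset.mp hI hi)).2
  have hcard : I.card ≤ l := by
    rw [← hsum, Finset.card_eq_sum_ones]
    exact (Finset.sum_le_sum hI').trans (Finset.sum_le_univ_sum_of_nonneg fun _ => Nat.zero_le _)
  have hexp : ((fun i => if i ∈ I then δ else 0) +
      fun i => ((lam i - (if i ∈ I then 1 else 0) : ℕ) : ℂ) * δ) = fun i => (lam i : ℂ) * δ := by
    funext i
    simp only [Pi.add_apply]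
    split_ifs with hi
    · rw [Nat.cast_sub (hI' i hi)]; push_cast; ring
    · simp
  rw [hexp, Nat.cast_sub hcard]
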